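/- Let $n\ge 0$ and $m=n+1$. Let $B_m$ be the group of signed permutations, i.e. bijections $\sigma$ of $\{\pm1,\dots,\pm m\}$ with $\sigma(-i)=-\sigma(i)$, under composition, with Coxeter generators $s_0=[-1,2,\dots,m]$ and $s_i=(i,\,i+1)$, $1\le i\le m-1$ (transposition of $i$ and $i+1$, extended by $s_i(-j)=-s_i(j)$). Here $\sigma=[\sigma(1),\dots,\sigma(m)]$ is the window notation. For $\sigma\in B_m$ let - $\ell_B(\sigma)$ be the length of $\sigma$ with respect to $s_0,\dots,s_{m-1}$; - $\mathrm{Neg}(\sigma)=\{i\in\{1,\dots,m\} : \sigma(i)<0\}$; - $\mathrm{del}_B(\sigma)=\#\{2\le j\le m : \sigma(i)>\sigma(j)\text{ for all }1\le i<j\}$; - $\ell_L(\sigma)=\ell_B(\sigma)-\mathrm{del}_B(\sigma)$ and $\ell_D(\sigma)=\ell_B(\sigma)-\#\mathrm{Neg}(\sigma)$. Let $L_{m}\subseteq B_{m}$ be the subgroup of those $\sigma$ for which $i\mapsto|\sigma(i)|$ is an even permutation of $\{1,\dots,m\}$, let $D_{m}\subseteq B_m$ be the subgroup of those $\sigma$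 for which $\#\mathrm{Neg}(\sigma)$ is even, and let $(L\cap D)_{n+1}=L_{n+1}\cap D_{n+1}$. With $a_i=s_1s_{i+1}$ for $1\le i\le n-1$, put for $\pi\in L_{n+1}$ $$\mathrm{Des}_A(\pi)=\{1\le i\le n-1 : \ell_L(\pi a_i)\le \ell_L(\pi)\},\qquad \mathrm{rmaj}_{L_{n+1}}(\pi)=\sum_{i\in \mathrm{Des}_A(\pi)}(n-i),$$ and for $\pi\in(L\cap D)_{n+1}$ $$\mathrm{drmaj}_{(L\cap D)_{n+1}}(\pi)=\mathrm{rmaj}_{L_{n+1}}(\pi)-\#\mathrm{Neg}(\pi)+\sum_{i\in \mathrm{Neg}(\pi^{-1})}i,\qquad \ell_{(L\cap D)}(\pi)=\ell_D(\pi)-\mathrm{del}_B(\pi).$$ Then $$\sum_{\pi\in(L\cap D)_{n+1}}q^{\mathrm{drmaj}_{(L\cap D)_{n+1}}(\pi)}=\sum_{\pi\in(L\cap D)_{n+1}}q^{\ell_{(L\cap D)}(\pi)}.$$ -/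

import Mathlib

namespace SignedEven

open Equiv

/-- The hyperoctahedral group `B_n`, as the wreath product `C₂ ≀ S_n`: pairs `(ε, w)` of a sign
vector `ε` and a permutation `w`, where `S_n` permutes the entries of `ε`.  Here `C₂ = {1, -1}` and
the letter `j ∈ [n] = {1, …, n}` is represented by the element `j - 1` of `Fin n`. -/
abbrev SignedPerm (n : ℕ) : Type :=
  SemidirectProduct (Fin n → ℤˣ) (Perm (Fin n)) mulAutArrow

instance (n : ℕ) : Finite (SignedPerm n) :=
  Finite.of_equiv _ SemidirectProduct.equivProd.symm

variable {n : ℕ}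

/-- The window notation `[σ(1), …, σ(n)]`: the pair `σ = (ε, w)` is thought of as the bijection of
`{±1, …, ±n}` with `σ(i) = ε_{w(i)} w(i)` and `σ(-i) = -σ(i)`. -/
def window (σ : SignedPerm n) (i : Fin n) : ℤ :=
  (σ.left (σ.right i) : ℤ) * ((σ.right i : ℕ) + 1)

/-- Multiplication in the wreath product is composition of bijections of `{±1, …, ±n}`: if
`τ(i) = ± j`, then `(σ τ)(i) = ± σ(j)`. -/
theorem window_mul (σ τ : SignedPerm n) (i : Fin n) :
    window (σ * τ) i = (τ.left (τ.right i) : ℤ) * window σ (τ.right i) := by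
  have h : (σ * τ).left (σ.right (τ.right i)) =
      σ.left (σ.right (τ.right i)) * τ.left (τ.right i) := by
    have h' : (σ * τ).left (σ.right (τ.right i)) =
        σ.left (σ.right (τ.right i)) * τ.left (σ.right⁻¹ (σ.right (τ.right i))) := rfl
    rw [h', Perm.inv_def, Equiv.symm_apply_apply]
  simp only [window, SemidirectProduct.mul_right, Perm.mul_apply, h, Units.val_mul]
  ring

/-- An element of `B_n` is determined by its window. -/
theorem window_injective : Function.Injective (window (n := n)) := by
  intro σ τ h
  have hu : ∀ (u : ℤˣ) (a : ℕ), ((u : ℤ) * (a + 1)).natAbs = a + 1 := by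
    intro u a
    rw [Int.natAbs_mul, Int.units_natAbs, one_mul]
    omega
  have hr : σ.right = τ.right := by
    ext i
    have := congrArg Int.natAbs (congrFun h i)
    simp only [window, hu] at this
    omega
  refine SemidirectProduct.ext ?_ hr
  funext j
  have := congrFun h (σ.right.symm j)
  simp only [window, ← hr, Equiv.apply_symm_apply] at this
  exact Units.ext (mul_right_cancel₀ (by omega) this)

/-- The Coxeter generators `s_0, s_1, …, s_{n-1}` of `B_n`:  `s_0 = [-1, 2, …, n]`, and `s_i` is the
adjacent transposition `(i, i + 1)` for `1 ≤ i ≤ n - 1`.  (Only indices `i < n` are used.) -/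
def s (n : ℕ) : ℕ → SignedPerm n
  | 0 => SemidirectProduct.inl fun j => if (j : ℕ) = 0 then -1 else 1
  | i + 1 =>
    if h : i + 1 < n then
      SemidirectProduct.inr (swap ⟨i, Nat.lt_of_succ_lt h⟩ ⟨i + 1, h⟩)
    else 1

/-- The `B`-length: the least length of an expression of `σ` as a product of the Coxeter generators
`s_0, …, s_{n-1}`. -/
noncomputable def lenB (σ : SignedPerm n) : ℕ :=
  sInf {k | ∃ l : List ℕ, l.length = k ∧ (∀ i ∈ l, i < n) ∧ (l.map (s n)).prod = σ}

/-- `del_B(σ)`: the number of `j` with `2 ≤ j ≤ n` such that `σ(i) > σ(j)` for all `1 ≤ i < j`. -/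
def delB (σ : SignedPerm n) : ℕ :=
  (Finset.univ.filter fun j : Fin n =>
    1 ≤ (j : ℕ) ∧ ∀ i : Fin n, i < j → window σ j < window σ i).card

/-- `Neg(σ) = {i ∈ [n] : σ(i) < 0}`. -/
def Neg (σ : SignedPerm n) : Finset (Fin n) :=
  Finset.univ.filter fun i => window σ i < 0

/-- `∑_{i ∈ Neg(σ⁻¹)} i`. -/
def sumNegInv (σ : SignedPerm n) : ℕ :=
  ∑ i ∈ Neg σ⁻¹, ((i : ℕ) + 1)

/-- The `L`-length `ℓ_L = ℓ_B - del_B`. -/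
noncomputable def lenL (σ : SignedPerm n) : ℤ :=
  (lenB σ : ℤ) - delB σ

/-- The `D`-length `ℓ_D = ℓ_B - #Neg`. -/
noncomputable def lenD (σ : SignedPerm n) : ℤ :=
  (lenB σ : ℤ) - (Neg σ).card

/-- `ℓ_{L ∩ D} = ℓ_D - del_B`. -/
noncomputable def lenLD (σ : SignedPerm n) : ℤ :=
  lenD σ - delB σ

/-- The elements `a_i = s_1 s_{i+1}` of `L_{n+1}`, for `1 ≤ i ≤ n - 1`. -/
def a (n i : ℕ) : SignedPerm (n + 1) :=
  s (n + 1) 1 * s (n + 1) (i + 1)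

/-- The `A`-descent set `Des_A(π) = {1 ≤ i ≤ n - 1 : ℓ_L(π a_i) ≤ ℓ_L(π)}` in rank `n + 1`. -/
noncomputable def DesA (π : SignedPerm (n + 1)) : Finset ℕ :=
  (Finset.Icc 1 (n - 1)).filter fun i => lenL (π * a n i) ≤ lenL π

/-- The alternating reverse major index `rmaj_{L_{n+1}}(π) = ∑_{i ∈ Des_A(π)} (n - i)`. -/
noncomputable def rmajL (π : SignedPerm (n + 1)) : ℤ :=
  ∑ i ∈ DesA π, ((n : ℤ) - i)

/-- `drmaj_{(L ∩ D)_{n+1}}(π) = rmaj_{L_{n+1}}(π) - #Neg(π) + ∑_{i ∈ Neg(π⁻¹)} i`. -/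
noncomputable def drmajLD (π : SignedPerm (n + 1)) : ℤ :=
  rmajL π - (Neg π).card + sumNegInv π

/-- `L_n = C₂ ≀ A_n`: the signed permutations whose underlying permutation is even. -/
def L (n : ℕ) : Subgroup (SignedPerm n) :=
  (alternatingGroup (Fin n)).comap SemidirectProduct.rightHom

theorem window_neg_iff (σ : SignedPerm n) (i : Fin n) :
    window σ i < 0 ↔ σ.left (σ.right i) = -1 := by
  unfold window
  rcases Int.units_eq_one_or (σ.left (σ.right i)) with h | h
  · simp only [h, Units.val_one, one_mul]
    constructor
    · intro h'
      omega
    · intro h'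
      exact absurd h' (by decide)
  · simp only [h, Units.val_neg, Units.val_one, iff_true]
    omega

/-- The product of the signs of `σ` is `1` or `-1` as the number of negative entries in its window
is even or odd. -/
theorem neg_one_pow_card_Neg (σ : SignedPerm n) :
    (-1 : ℤˣ) ^ (Neg σ).card = ∏ j, σ.left j := by
  rw [← Equiv.prod_comp σ.right σ.left, ← Finset.prod_const, Neg, Finset.prod_filter]
  refine Finset.prod_congr rfl fun i _ => ?_
  simp only [window_neg_iff]
  rcases Int.units_eq_one_or (σ.left (σ.right i)) with h | h <;> simp [h]

theorem even_card_Neg_iff (σ : SignedPerm n) :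
    Even (Neg σ).card ↔ ∏ j, σ.left j = 1 := by
  rw [← neg_one_pow_card_Neg, neg_one_pow_eq_one_iff_even (by decide)]

theorem prod_left_mul (σ τ : SignedPerm n) :
    ∏ j, (σ * τ).left j = (∏ j, σ.left j) * ∏ j, τ.left j := by
  rw [← Equiv.prod_comp σ.right⁻¹ τ.left, ← Finset.prod_mul_distrib]
  rfl

/-- `D_n`: the signed permutations with an even number of negative entries in their window. -/
def D (n : ℕ) : Subgroup (SignedPerm n) where
  carrier := {σ | Even (Neg σ).card}
  one_mem' := by
    simp [even_card_Neg_iff]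
  mul_mem' := by
    intro σ τ hσ hτ
    simp only [Set.mem_ofPred_eq, even_card_Neg_iff] at *
    rw [prod_left_mul, hσ, hτ, one_mul]
  inv_mem' := by
    intro σ hσ
    simp only [Set.mem_ofPred_eq, even_card_Neg_iff] at *
    have h := prod_left_mul σ⁻¹ σ
    rw [hσ, mul_one, inv_mul_cancel] at h
    rw [← h]
    simp

/-- `(L ∩ D)_n = L_n ∩ D_n`, the group of even-signed even permutations. -/
def LD (n : ℕ) : Subgroup (SignedPerm n) := L n ⊓ D n

noncomputable instance (n : ℕ) : Fintype (LD n) := Fintype.ofFinite _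

end SignedEven

/-!
Write a signed permutation as a pair `(e, w)`: for a fixed sign vector `e`, its window, read as a
word, is a rearrangement by `w` of fixed distinct integers. The `B`-length is the number of
inversions of the word plus the sum of the absolute values of its negative letters (`lenB_eq`), and
this sum and the number of negative letters depend on `e` alone. So both exponents are the same
function of `e` plus a statistic of the word: `wordLen`, inversions minus left-to-right minima, on
the length side, and `wordMaj`, the alternating reverse major index, on the other. It remains to
see that, for each `e`, these two have the same distribution as `w` runs over the even permutations.

Exchanging the first two letters changes neither statistic, so that a sum over the even
permutations is half of the sum over all permutations (`two_mul_sum_alternatingGroup`). For this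
one needs a description of `wordMaj` free of lengths: the position of adjacent letters `x, y` is a
descent exactly if `y < max x μ`, where `μ` is the minimum of the letters before `x`
(`reducedInv_swap_le_iff`, `wordMaj_eq_sum`).

Over all rearrangements, the two are equidistributed by insertion of the largest letter. Inserted
in all possible ways into a nonempty word of `k` letters, it multiplies the generating function by
`(1 + q + ⋯ + q ^ (k - 1)) + q ^ (k - 1)` for either statistic (`sum_wordMaj_insert`,
`sum_wordLen_insert`).
-/

namespace SignedEven

open Equiv LaurentPolynomial

/-! ### Words: inversions, left-to-right minima and the alternating major index -/

/-- The number of inversions of a word. -/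
def inv : List ℤ → ℕ
  | [] => 0
  | x :: l => l.countP (· < x) + inv l

/-- The number of letters of a word that are smaller than `m` and than all letters before them,
that is, the left-to-right minima that the word contributes when it follows a prefix with
minimum `m`. -/
def lrMin : ℤ → List ℤ → ℕ
  | _, [] => 0
  | m, x :: l => (if x < m then 1 else 0) + lrMin (min m x) l

/-- The alternating reverse major index of a word that follows a nonempty prefix with minimum `m`.
Adjacent letters `x, y` form a descent if `y < max x μ`, where `μ` is the minimum of everything
before `x`; a descent is weighted by the number of letters from `y` on. -/
def altMaj : ℤ → List ℤ → ℤ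
  | m, x :: y :: l =>
    (if y < max x m then (l.length : ℤ) + 1 else 0) + altMaj (min m x) (y :: l)
  | _, _ => 0

/-- Exchange the letters at the (zero-based) positions `k` and `k + 1`. -/
def swapAt : ℕ → List ℤ → List ℤ
  | 0, x :: y :: l => y :: x :: l
  | k + 1, x :: l => x :: swapAt k l
  | _, l => l

/-- Inversions minus left-to-right minima, for a word following a prefix with minimum `m`. -/
def reducedInv (m : ℤ) (l : List ℤ) : ℤ := (inv l : ℤ) - lrMin m l

/-- Inversions minus left-to-right minima of a word, the first letter not being counted as a
minimum. -/
def wordLen : List ℤ → ℤ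
  | [] => 0
  | x :: l => (inv (x :: l) : ℤ) - lrMin x l

/-- The alternating reverse major index of a word. -/
def wordMaj : List ℤ → ℤ
  | [] => 0
  | x :: l => altMaj x l

theorem length_swapAt (k : ℕ) (l : List ℤ) : (swapAt k l).length = l.length := by
  induction k, l using swapAt.induct <;> simp_all [swapAt]

theorem swapAt_perm (k : ℕ) (l : List ℤ) : (swapAt k l).Perm l := by
  induction k, l using swapAt.induct with
  | case1 x y l => exact List.Perm.swap _ _ _
  | case2 k x l ih => exact ih.cons x
  | case3 k l h1 h2 => rw [swapAt]; exacts [h1, h2]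

theorem getElem?_swapAt (k : ℕ) (l : List ℤ) (h : k + 1 < l.length) (j : ℕ) :
    (swapAt k l)[j]? = if j = k then l[k + 1]? else if j = k + 1 then l[k]? else l[j]? := by
  induction k generalizing l j with
  | zero =>
    match l, h with
    | x :: y :: l, _ => rcases j with _ | _ | j <;> simp [swapAt]
  | succ k ih =>
    match l, h with
    | x :: l, h =>
      rcases j with _ | j
      · simp [swapAt]
      · simp only [swapAt, List.getElem?_cons_succ, add_left_inj]
        exact ih l (by simpa using h) j

theorem ofFn_comp_swap {n : ℕ} (x : Fin n → ℤ) (k : ℕ) (h : k + 1 < n) :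
    List.ofFn (x ∘ swap ⟨k, Nat.lt_of_succ_lt h⟩ ⟨k + 1, h⟩) = swapAt k (List.ofFn x) := by
  apply List.ext_getElem?
  intro j
  rw [getElem?_swapAt _ _ (by simpa using h)]
  by_cases hj : j < n
  · simp only [List.getElem?_ofFn, hj, h, Nat.lt_of_succ_lt h, Function.comp_apply, dite_true,
      swap_apply_def, Fin.mk.injEq]
    split_ifs <;> rfl
  · have h1 : j ≠ k := by omega
    have h2 : j ≠ k + 1 := by omega
    simp [hj, h1, h2]

theorem inv_swapAt (k : ℕ) (l : List ℤ) (h : k + 1 < l.length) :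
    inv (swapAt k l) + (if l[k + 1] < l[k] then 1 else 0) =
      inv l + (if l[k] < l[k + 1] then 1 else 0) := by
  induction k generalizing l with
  | zero =>
    match l, h with
    | x :: y :: l, _ =>
      simp only [swapAt, inv, List.countP_cons, decide_eq_true_eq, List.getElem_cons_zero,
        List.getElem_cons_succ, zero_add]
      omega
  | succ k ih =>
    match l, h with
    | x :: l, h =>
      have := ih l (by simpa using h)
      simp only [swapAt, inv, List.getElem_cons_succ, (swapAt_perm k l).countP_eq]
      omega

theorem reducedInv_cons (m x : ℤ) (l : List ℤ) :
    reducedInv m (x :: l) =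
      l.countP (· < x) - (if x < m then 1 else 0) + reducedInv (min m x) l := by
  simp only [reducedInv, inv, lrMin]
  push_cast
  ring

theorem wordLen_cons (x : ℤ) (l : List ℤ) :
    wordLen (x :: l) = l.countP (· < x) + reducedInv x l := by
  simp only [wordLen, reducedInv, inv]
  push_cast
  ring

/-- The descents of `altMaj` are the positions where an exchange does not increase `reducedInv`. -/
theorem reducedInv_swap_le_iff (m x y : ℤ) (l : List ℤ) (hxy : x ≠ y) :
    reducedInv m (y :: x :: l) ≤ reducedInv m (x :: y :: l) ↔ y < max x m := by
  simp only [reducedInv_cons, List.countP_cons, decide_eq_true_eq, min_right_comm m y x]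
  push_cast
  simp only [lt_min_iff, lt_max_iff]
  split_ifs <;> omega

theorem altMaj_eq_sum (m : ℤ) (l : List ℤ) (hl : l.Nodup) :
    altMaj m l = ∑ k ∈ Finset.range (l.length - 1),
      if reducedInv m (swapAt k l) ≤ reducedInv m l then (l.length : ℤ) - 1 - k else 0 := by
  induction l generalizing m with
  | nil => simp [altMaj]
  | cons x l ih =>
    match l, hl, ih with
    | [], _, _ => simp [altMaj]
    | y :: l, hl, ih =>
      have hxy : x ≠ y := by
        rintro rfl
        simp at hl
      have key : ∀ k, reducedInv m (swapAt (k + 1) (x :: y :: l)) ≤ reducedInv m (x :: y :: l) ↔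
          reducedInv (min m x) (swapAt k (y :: l)) ≤ reducedInv (min m x) (y :: l) := by
        intro k
        simp only [swapAt, reducedInv_cons m x, (swapAt_perm k (y :: l)).countP_eq]
        omega
      rw [altMaj, ih _ (List.nodup_cons.1 hl).2]
      simp only [List.length_cons, Nat.add_sub_cancel, Finset.sum_range_succ', key]
      rw [swapAt, add_comm]
      simp only [reducedInv_swap_le_iff _ _ _ _ hxy]
      congr 1
      · refine Finset.sum_congr rfl fun k _ => ?_
        push_cast
        split_ifs <;> ring
      · push_cast
        split_ifs <;> ring

theorem wordLen_swapAt_zero (l : List ℤ) (hl : l.Nodup) : wordLen (swapAt 0 l) = wordLen l := by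
  match l, hl with
  | [], _ => rfl
  | [x], _ => rfl
  | x :: y :: l, hl =>
    have hxy : x ≠ y := by
      rintro rfl
      simp at hl
    simp only [swapAt, wordLen_cons, reducedInv_cons, List.countP_cons, decide_eq_true_eq,
      min_comm y x]
    push_cast
    split_ifs <;> omega

theorem wordMaj_swapAt_zero (l : List ℤ) : wordMaj (swapAt 0 l) = wordMaj l := by
  match l with
  | [] => rfl
  | [x] => rfl
  | [x, y] => rfl
  | x :: y :: z :: l => simp only [swapAt, wordMaj, altMaj, min_comm y x, max_comm y x]

/-- The alternating major index in terms of `wordLen` alone, with the initial exchange of the first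
two letters that right multiplication by `s₁` performs. -/
theorem wordMaj_eq_sum (l : List ℤ) (hl : l.Nodup) :
    wordMaj l = ∑ k ∈ Finset.range (l.length - 2),
      if wordLen (swapAt (k + 1) (swapAt 0 l)) ≤ wordLen l then (l.length : ℤ) - 2 - k else 0 := by
  rw [← wordMaj_swapAt_zero]
  have hl' : (swapAt 0 l).Nodup := (swapAt_perm 0 l).nodup_iff.2 hl
  rw [← length_swapAt 0 l, ← wordLen_swapAt_zero l hl]
  generalize swapAt 0 l = l at hl'
  match l, hl' with
  | [], _ => rfl
  | x :: l, hl' =>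
    rw [wordMaj, altMaj_eq_sum _ _ (List.nodup_cons.1 hl').2]
    refine Finset.sum_congr rfl fun k _ => ?_
    simp only [swapAt, wordLen_cons, (swapAt_perm k l).countP_eq, add_le_add_iff_left,
      List.length_cons]
    push_cast
    split_ifs <;> ring

/-! ### Insertion of a largest letter -/

/-- `1 + q + ⋯ + q ^ (k - 1)`. -/
noncomputable def qInt (k : ℕ) : LaurentPolynomial ℤ := ∑ i ∈ Finset.range k, T (i : ℤ)

theorem qInt_succ (k : ℕ) : qInt (k + 1) = qInt k + T (k : ℤ) := Finset.sum_range_succ _ _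

theorem qInt_succ' (k : ℕ) : qInt (k + 1) = T 1 * qInt k + 1 := by
  rw [qInt, Finset.sum_range_succ', qInt, Finset.mul_sum]
  simp only [← T_add, Nat.cast_zero, T_zero, Nat.cast_succ, add_comm (1 : ℤ)]

theorem perm_of_mem_permutations'Aux {M : ℤ} {l u : List ℤ}
    (hu : u ∈ List.permutations'Aux M l) : u.Perm (M :: l) := by
  induction l generalizing u with
  | nil => simp_all [List.permutations'Aux]
  | cons x l ih =>
    simp only [List.permutations'Aux, List.mem_cons, List.mem_map] at hu
    rcases hu with rfl | ⟨v, hv, rfl⟩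
    · rfl
    · exact ((ih hv).cons x).trans (List.Perm.swap _ _ _)

/-- Inserting a letter `M` above all others after the first letter of `x :: l` changes the
alternating major index by `0, 1, …, |l|`, each once. -/
theorem sum_altMaj_insert (M : ℤ) (l : List ℤ) (hl : ∀ z ∈ l, z < M) (m x : ℤ) (hm : m < M)
    (hx : x < M) :
    ((List.permutations'Aux M l).map fun u => (T (altMaj m (x :: u)) : LaurentPolynomial ℤ)).sum =
      T (altMaj m (x :: l)) * qInt (l.length + 1) := by
  induction l generalizing m x with
  | nil => simp [List.permutations'Aux, altMaj, not_lt.2 hx.le, not_lt.2 hm.le, qInt]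
  | cons y l ih =>
    have hy : y < M := hl y (by simp)
    have ih := ih (fun z hz => hl z (by simp [hz])) (min m x) y (by simp [hm]) hy
    have hlen : ∀ u ∈ List.permutations'Aux M l, u.length = l.length + 1 := fun u hu => by
      simpa using (perm_of_mem_permutations'Aux hu).length_eq
    have h1 : ((List.permutations'Aux M l).map fun u =>
        (T (altMaj m (x :: y :: u)) : LaurentPolynomial ℤ)) =
        (List.permutations'Aux M l).map fun u =>
          T (if y < max x m then (l.length : ℤ) + 2 else 0) * T (altMaj (min m x) (y :: u)) := by
      refine List.map_congr_left fun u hu => ?_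
      rw [altMaj, hlen u hu, ← T_add]
      push_cast
      congr 2
    have h2 : altMaj m (x :: M :: y :: l) = l.length + 1 + altMaj (min m x) (y :: l) := by
      simp [altMaj, hx.le, hm.le, hy]
    simp only [List.permutations'Aux, List.map_cons, List.map_map, Function.comp_def, List.sum_cons]
    rw [h1, List.sum_map_mul_left, ih, h2, altMaj]
    generalize altMaj (min m x) (y :: l) = c
    simp only [List.length_cons, T_add]
    split_ifs
    · rw [qInt_succ' (l.length + 1), show (l.length : ℤ) + 2 = l.length + 1 + 1 by ring]
      simp only [T_add]
      ring
    · rw [qInt_succ (l.length + 1)]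
      push_cast
      simp only [T_add, T_zero]
      ring

/-- Inserting a letter above all others into a nonempty word `u` changes `wordMaj` by
`0, 1, …, |u| - 1` and once more by `|u| - 1`. -/
theorem sum_wordMaj_insert (M : ℤ) (u : List ℤ) (hu : ∀ z ∈ u, z < M) (h0 : u ≠ []) :
    ((List.permutations'Aux M u).map fun v => (T (wordMaj v) : LaurentPolynomial ℤ)).sum =
      T (wordMaj u) * (qInt u.length + T ((u.length : ℤ) - 1)) := by
  match u, hu with
  | [a], hu => simp [List.permutations'Aux, wordMaj, altMaj, qInt]
  | a :: b :: l, hu =>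
    simp only [List.mem_cons, forall_eq_or_imp] at hu
    have h := sum_altMaj_insert M l hu.2.2 a b hu.1 hu.2.1
    simp only [List.permutations'Aux, List.map_cons, List.map_map, Function.comp_def,
      List.sum_cons, wordMaj, List.length_cons]
    rw [h, qInt_succ (l.length + 1)]
    have h1 : altMaj M (a :: b :: l) = l.length + 1 + altMaj a (b :: l) := by
      simp [altMaj, hu.1.le, hu.2.1]
    have h2 : altMaj a (M :: b :: l) = l.length + 1 + altMaj a (b :: l) := by
      simp [altMaj, hu.1.le, hu.2.1]
    rw [h1, h2]
    push_cast
    simp only [T_add, add_sub_cancel_right]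
    ring

/-- Inserting a letter above all others and above `m` changes `reducedInv m` by `0, 1, …, |l|`, each
once. -/
theorem sum_reducedInv_insert (M : ℤ) (l : List ℤ) (hl : ∀ z ∈ l, z < M) (m : ℤ) (hm : m < M) :
    ((List.permutations'Aux M l).map fun u => (T (reducedInv m u) : LaurentPolynomial ℤ)).sum =
      T (reducedInv m l) * qInt (l.length + 1) := by
  induction l generalizing m with
  | nil => simp [List.permutations'Aux, reducedInv, inv, lrMin, not_lt.2 hm.le, qInt]
  | cons x l ih =>
    have hx : x < M := hl x (by simp)
    have hl' : ∀ z ∈ l, z < M := fun z hz => hl z (by simp [hz])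
    have h1 : ((List.permutations'Aux M l).map fun u =>
        (T (reducedInv m (x :: u)) : LaurentPolynomial ℤ)) =
        (List.permutations'Aux M l).map fun u =>
          T ((l.countP (· < x) : ℤ) - (if x < m then 1 else 0)) * T (reducedInv (min m x) u) := by
      refine List.map_congr_left fun u hu => ?_
      rw [reducedInv_cons, ← T_add]
      have h := (perm_of_mem_permutations'Aux hu).countP_eq (p := (· < x))
      rw [List.countP_cons_of_neg (by simpa using hx.le)] at h
      rw [h]
    have h2 : reducedInv m (M :: x :: l) = l.length + 1 + reducedInv m (x :: l) := by
      have : (x :: l).countP (· < M) = (x :: l).length := List.countP_eq_length.2 (by simpa using hl)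
      rw [reducedInv_cons, this, if_neg (not_lt.2 hm.le), min_eq_left hm.le]
      push_cast [List.length_cons]
      ring
    simp only [List.permutations'Aux, List.map_cons, List.map_map, Function.comp_def, List.sum_cons]
    rw [h1, List.sum_map_mul_left, ih hl' _ (by simp [hm]), h2, List.length_cons,
      qInt_succ (l.length + 1), reducedInv_cons m x]
    push_cast
    simp only [T_add]
    ring

/-- Inserting a letter above all others into a nonempty word `u` changes `wordLen` by
`0, 1, …, |u| - 1` and once more by `|u| - 1`, just as it changes `wordMaj`. -/
theorem sum_wordLen_insert (M : ℤ) (u : List ℤ) (hu : ∀ z ∈ u, z < M) (h0 : u ≠ []) :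
    ((List.permutations'Aux M u).map fun v => (T (wordLen v) : LaurentPolynomial ℤ)).sum =
      T (wordLen u) * (qInt u.length + T ((u.length : ℤ) - 1)) := by
  match u, hu with
  | a :: l, hu =>
    have ha : a < M := hu a (by simp)
    have h1 : wordLen (M :: a :: l) = l.length + wordLen (a :: l) := by
      have : (a :: l).countP (· < M) = (a :: l).length := List.countP_eq_length.2 (by simpa using hu)
      rw [wordLen_cons, wordLen_cons, reducedInv_cons, this, if_pos ha, min_eq_right ha.le]
      push_cast [List.length_cons]
      ring
    have h2 : ((List.permutations'Aux M l).map fun u =>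
        (T (wordLen (a :: u)) : LaurentPolynomial ℤ)) =
        (List.permutations'Aux M l).map fun u =>
          T (l.countP (· < a) : ℤ) * T (reducedInv a u) := by
      refine List.map_congr_left fun u hu => ?_
      have h := (perm_of_mem_permutations'Aux hu).countP_eq (p := (· < a))
      rw [List.countP_cons_of_neg (by simpa using ha.le)] at h
      rw [wordLen_cons, ← T_add, h]
    simp only [List.permutations'Aux, List.map_cons, List.map_map, Function.comp_def, List.sum_cons]
    rw [h2, List.sum_map_mul_left,
      sum_reducedInv_insert M l (fun z hz => hu z (by simp [hz])) a ha, h1, wordLen_cons]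
    push_cast [List.length_cons]
    simp only [T_add, add_sub_cancel_right]
    ring

/-- `wordMaj` and `wordLen` are equidistributed over the rearrangements of a decreasing list, by
insertion of its first letter into the rearrangements of the others. -/
theorem sum_permutations'_eq_of_pairwise (l : List ℤ) (hl : l.Pairwise (· > ·)) :
    (l.permutations'.map fun u => (T (wordMaj u) : LaurentPolynomial ℤ)).sum =
      (l.permutations'.map fun u => (T (wordLen u) : LaurentPolynomial ℤ)).sum := by
  induction l with
  | nil => simp [wordMaj, wordLen]
  | cons M l ih =>
    obtain ⟨hM, hl⟩ := List.pairwise_cons.1 hl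
    rcases eq_or_ne l [] with rfl | h0
    · simp [List.permutations'Aux, wordMaj, altMaj, wordLen, inv, lrMin]
    have hu : ∀ u ∈ l.permutations', u.length = l.length ∧ (∀ z ∈ u, z < M) ∧ u ≠ [] := by
      intro u hu
      have hp := List.mem_permutations'.1 hu
      exact ⟨hp.length_eq, fun z hz => hM z (hp.mem_iff.1 hz), fun h => h0 (by simpa [h] using hp)⟩
    have h1 : ∀ f : List ℤ → LaurentPolynomial ℤ, (∀ u ∈ l.permutations',
        ((List.permutations'Aux M u).map f).sum =
          f u * (qInt l.length + T ((l.length : ℤ) - 1))) →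
        ((M :: l).permutations'.map f).sum =
          (l.permutations'.map f).sum * (qInt l.length + T ((l.length : ℤ) - 1)) := by
      intro f hf
      rw [← List.sum_map_mul_right, List.permutations', List.map_flatMap, List.flatMap,
        List.sum_flatten, List.map_map]
      exact congrArg List.sum (List.map_congr_left hf)
    rw [h1, h1, ih hl]
    · intro u h
      rw [sum_wordLen_insert M u (hu u h).2.1 (hu u h).2.2, (hu u h).1]
    · intro u h
      rw [sum_wordMaj_insert M u (hu u h).2.1 (hu u h).2.2, (hu u h).1]

theorem sum_ofFn_comp_perm {n : ℕ} (x : Fin n → ℤ) (hx : Function.Injective x)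
    (f : List ℤ → LaurentPolynomial ℤ) :
    ∑ w : Perm (Fin n), f (List.ofFn (x ∘ w)) =
      ∑ u ∈ (List.ofFn x).permutations'.toFinset, f u := by
  have hinj : Function.Injective fun w : Perm (Fin n) => List.ofFn (x ∘ w) := by
    intro w w' h
    ext i
    exact congrArg Fin.val (hx (congrFun (List.ofFn_injective h) i))
  rw [← Finset.sum_image (s := Finset.univ) (g := fun w : Perm (Fin n) => List.ofFn (x ∘ w))
    (f := f) hinj.injOn]
  refine Finset.sum_congr (Finset.eq_of_subset_of_card_le ?_ ?_) fun _ _ => rfl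
  · intro u hu
    obtain ⟨w, -, rfl⟩ := Finset.mem_image.1 hu
    exact List.mem_toFinset.2 (List.mem_permutations'.2 (Equiv.Perm.ofFn_comp_perm w x))
  · rw [Finset.card_image_of_injective _ hinj, Finset.card_univ, Fintype.card_perm,
      Fintype.card_fin]
    refine (List.toFinset_card_le _).trans ?_
    rw [← (List.permutations_perm_permutations' _).length_eq, List.length_permutations,
      List.length_ofFn]

/-- Over all rearrangements of distinct integers, `wordMaj` and `wordLen` are equidistributed. -/
theorem sum_wordMaj_eq_sum_wordLen {n : ℕ} (x : Fin n → ℤ) (hx : Function.Injective x) :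
    ∑ w : Perm (Fin n), (T (wordMaj (List.ofFn (x ∘ w))) : LaurentPolynomial ℤ) =
      ∑ w : Perm (Fin n), (T (wordLen (List.ofFn (x ∘ w))) : LaurentPolynomial ℤ) := by
  have hnd : (List.ofFn x).Nodup := List.nodup_ofFn.2 hx
  -- `permutations'` inserts the letters of a list from its last to its first, so a decreasing list
  -- makes each inserted letter the largest so far.
  have hp : ((List.ofFn x).mergeSort (· ≥ ·)).Perm (List.ofFn x) := List.mergeSort_perm _ _
  have hs : ((List.ofFn x).mergeSort (· ≥ ·)).Pairwise (· > ·) := by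
    have h1 : ((List.ofFn x).mergeSort (· ≥ ·)).Pairwise (· ≥ ·) := List.pairwise_mergeSort' _ _
    have h2 : ((List.ofFn x).mergeSort (· ≥ ·)).Pairwise (· ≠ ·) := hp.nodup_iff.2 hnd
    exact (h1.and h2).imp fun h => lt_of_le_of_ne h.1 h.2.symm
  have hf : (List.ofFn x).permutations'.toFinset =
      ((List.ofFn x).mergeSort (· ≥ ·)).permutations'.toFinset := by
    ext u
    simp only [List.mem_toFinset, List.mem_permutations']
    exact ⟨fun h => h.trans hp.symm, fun h => h.trans hp⟩
  have hnd' : ((List.ofFn x).mergeSort (· ≥ ·)).permutations'.Nodup :=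
    (List.permutations_perm_permutations' _).nodup_iff.1
      (List.nodup_permutations _ (hp.nodup_iff.2 hnd))
  rw [sum_ofFn_comp_perm x hx fun u => T (wordMaj u),
    sum_ofFn_comp_perm x hx fun u => T (wordLen u), hf, List.sum_toFinset _ hnd',
    List.sum_toFinset _ hnd']
  exact sum_permutations'_eq_of_pairwise _ hs

/-! ### The Coxeter length of a signed permutation -/

/-- The window of a signed permutation, as a word. -/
def word {n : ℕ} (σ : SignedPerm n) : List ℤ := List.ofFn (window σ)

theorem length_word {n : ℕ} (σ : SignedPerm n) : (word σ).length = n := List.length_ofFn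

theorem window_injective_right {n : ℕ} (σ : SignedPerm n) : Function.Injective (window σ) := by
  intro i j h
  have := congrArg Int.natAbs h
  simp only [window, Int.natAbs_mul, Int.units_natAbs, one_mul] at this
  exact σ.right.injective (Fin.ext (by omega))

theorem nodup_word {n : ℕ} (σ : SignedPerm n) : (word σ).Nodup :=
  List.nodup_ofFn.2 (window_injective_right σ)

theorem word_mul_s_succ {n k : ℕ} (h : k + 1 < n) (σ : SignedPerm n) :
    word (σ * s n (k + 1)) = swapAt k (word σ) := by
  rw [word, word, ← ofFn_comp_swap _ k h]
  congr 1
  funext i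
  rw [window_mul]
  simp [s, h]

theorem left_mul_s_succ {n : ℕ} (k : ℕ) (σ : SignedPerm n) :
    (σ * s n (k + 1)).left = σ.left := by
  by_cases h : k + 1 < n
  · simp [s, h]
  · simp [s, h]

theorem s_mul_self {n : ℕ} (i : ℕ) : s n i * s n i = 1 := by
  rcases i with _ | k
  · rw [s, ← map_mul, ← map_one SemidirectProduct.inl]
    congr 1
    funext j
    simp only [Pi.mul_apply, Pi.one_apply]
    split_ifs <;> simp
  · by_cases h : k + 1 < n
    · simp only [s, h, dite_true, ← map_mul, swap_mul_self, map_one]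
    · simp [s, h]

theorem sumNegInv_eq {n : ℕ} (σ : SignedPerm n) :
    sumNegInv σ = ∑ j : Fin n, if σ.left j = -1 then (j : ℕ) + 1 else 0 := by
  rw [sumNegInv, Neg, Finset.sum_filter]
  refine Finset.sum_congr rfl fun j _ => ?_
  have : σ⁻¹.left (σ⁻¹.right j) = (σ.left j)⁻¹ := by
    have h' : σ⁻¹.left (σ⁻¹.right j) = (σ.left (σ.right (σ.right⁻¹ j)))⁻¹ := rfl
    rw [h', Perm.inv_def, Equiv.apply_symm_apply]
  simp only [window_neg_iff, this, inv_eq_iff_eq_inv, inv_neg, inv_one]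

theorem card_Neg_eq {n : ℕ} (σ : SignedPerm n) :
    (Neg σ).card = ∑ j : Fin n, if σ.left j = -1 then 1 else 0 := by
  rw [← Equiv.sum_comp σ.right, Neg, Finset.card_filter]
  simp only [window_neg_iff]

theorem countP_ofFn {n : ℕ} (x : Fin n → ℤ) (p : ℤ → Prop) [DecidablePred p] :
    (List.ofFn x).countP (p ·) = ∑ i, if p (x i) then 1 else 0 := by
  induction n with
  | zero => simp
  | succ n ih =>
    rw [List.ofFn_succ, List.countP_cons, ih, Fin.sum_univ_succ, add_comm]
    simp

theorem word_succ {n : ℕ} (σ : SignedPerm (n + 1)) :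
    word σ = window σ 0 :: List.ofFn fun i : Fin n => window σ i.succ := List.ofFn_succ

theorem word_mul_s_zero {n : ℕ} (σ : SignedPerm (n + 1)) :
    word (σ * s (n + 1) 0) = -window σ 0 :: List.ofFn fun i : Fin n => window σ i.succ := by
  rw [word_succ]
  congr 1
  · simp [window_mul, s]
  · congr 1
    funext i
    simp [window_mul, s]

/-- If `|σ(1)| = c`, then `c - 1` of the letters after the first lie strictly between `-c` and `c`.
Since `σ.right 0` is zero-based, `c - 1` is `σ.right 0` itself. -/
theorem countP_tail_window {n : ℕ} (σ : SignedPerm (n + 1)) :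
    (List.ofFn fun i : Fin n => window σ i.succ).countP (· < ((σ.right 0 : ℕ) : ℤ) + 1) =
      (List.ofFn fun i : Fin n => window σ i.succ).countP (· < -(((σ.right 0 : ℕ) : ℤ) + 1)) +
        (σ.right 0 : ℕ) := by
  have h : (σ.right 0 : ℕ) = ∑ i : Fin n, if σ.right i.succ < σ.right 0 then 1 else 0 := by
    have h1 := Equiv.sum_comp σ.right fun j => if j < σ.right 0 then 1 else 0
    rw [Fin.sum_univ_succ, if_neg (lt_irrefl _), zero_add] at h1
    rw [h1, ← Finset.card_filter, Finset.filter_gt_eq_Iio, Fin.card_Iio]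
  have key : (List.ofFn fun i : Fin n => window σ i.succ).countP
      (· < ((σ.right 0 : ℕ) : ℤ) + 1) =
      (List.ofFn fun i : Fin n => window σ i.succ).countP (· < -(((σ.right 0 : ℕ) : ℤ) + 1)) +
        ∑ i : Fin n, if σ.right i.succ < σ.right 0 then 1 else 0 := by
    rw [countP_ofFn _ (· < ((σ.right 0 : ℕ) : ℤ) + 1),
      countP_ofFn _ (· < -(((σ.right 0 : ℕ) : ℤ) + 1)), ← Finset.sum_add_distrib]
    refine Finset.sum_congr rfl fun i _ => ?_
    have hne : (σ.right i.succ : ℕ) ≠ (σ.right 0 : ℕ) := fun h =>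
      absurd (σ.right.injective (Fin.ext h)) (Fin.succ_ne_zero i)
    have hw : window σ i.succ = (σ.right i.succ : ℕ) + 1 ∨
        window σ i.succ = -((σ.right i.succ : ℕ) + 1) := by
      rcases Int.units_eq_one_or (σ.left (σ.right i.succ)) with h | h <;> simp [window, h]
    simp only [Fin.lt_def]
    split_ifs <;> omega
  rw [key, ← h]

theorem sumNegInv_mul_s_zero {n : ℕ} (σ : SignedPerm (n + 1)) :
    sumNegInv (σ * s (n + 1) 0) + (if σ.left (σ.right 0) = -1 then (σ.right 0 : ℕ) + 1 else 0) =
      sumNegInv σ + (if σ.left (σ.right 0) = -1 then 0 else (σ.right 0 : ℕ) + 1) := by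
  have hl : ∀ i, (σ * s (n + 1) 0).left (σ.right i) =
      σ.left (σ.right i) * (if i = 0 then -1 else 1) := by
    intro i
    have h' : (σ * s (n + 1) 0).left (σ.right i) =
      σ.left (σ.right i) * (s (n + 1) 0).left (σ.right⁻¹ (σ.right i)) := rfl
    rw [h', Perm.inv_def, Equiv.symm_apply_apply]
    simp only [s, SemidirectProduct.left_inl, Fin.val_eq_zero_iff]
  rw [sumNegInv_eq, sumNegInv_eq, ← Equiv.sum_comp σ.right, ← Equiv.sum_comp σ.right
    fun j => if σ.left j = -1 then (j : ℕ) + 1 else 0, Fin.sum_univ_succ, Fin.sum_univ_succ]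
  simp only [hl, Fin.succ_ne_zero, if_true, if_false, mul_one]
  rcases Int.units_eq_one_or (σ.left (σ.right 0)) with h | h <;> rw [h] <;> simp
  · omega
  · omega

/-- The closed formula for the `B`-length: inversions plus the sum of the absolute values of the
negative letters. -/
def invLen {n : ℕ} (σ : SignedPerm n) : ℕ := inv (word σ) + sumNegInv σ

theorem invLen_mul_s_succ {n k : ℕ} (h : k + 1 < n) (σ : SignedPerm n) :
    invLen (σ * s n (k + 1)) +
        (if window σ ⟨k + 1, h⟩ < window σ ⟨k, Nat.lt_of_succ_lt h⟩ then 1 else 0) =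
      invLen σ + (if window σ ⟨k, Nat.lt_of_succ_lt h⟩ < window σ ⟨k + 1, h⟩ then 1 else 0) := by
  have h1 := inv_swapAt k (word σ) (by rwa [length_word])
  simp only [word, List.getElem_ofFn] at h1
  simp only [invLen, word_mul_s_succ h, sumNegInv_eq, left_mul_s_succ]
  simp only [word]
  omega

theorem invLen_mul_s_zero {n : ℕ} (σ : SignedPerm (n + 1)) :
    invLen (σ * s (n + 1) 0) + (if window σ 0 < 0 then 1 else 0) =
      invLen σ + (if window σ 0 < 0 then 0 else 1) := by
  have h1 := sumNegInv_mul_s_zero σ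
  have h2 := countP_tail_window σ
  simp only [invLen, word_mul_s_zero, word_succ σ, inv, window_neg_iff]
  have hw : window σ 0 = (σ.left (σ.right 0) : ℤ) * ((σ.right 0 : ℕ) + 1) := rfl
  rw [hw]
  rcases Int.units_eq_one_or (σ.left (σ.right 0)) with h | h <;> rw [h] at h1 ⊢ <;>
    simp only [Units.val_one, Units.val_neg, one_mul, neg_mul, neg_neg, if_true,
      show (1 : ℤˣ) ≠ -1 by decide, if_false] at h1 ⊢ <;> omega

theorem invLen_one {n : ℕ} : invLen (1 : SignedPerm n) = 0 := by
  have h : ∀ l : List ℤ, l.Pairwise (· < ·) → inv l = 0 := by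
    intro l hl
    induction l with
    | nil => rfl
    | cons x l ih =>
      obtain ⟨hx, hl⟩ := List.pairwise_cons.1 hl
      rw [inv, ih hl, List.countP_eq_zero.2 (by simpa using fun y hy => (hx y hy).le)]
  rw [invLen, sumNegInv_eq, h]
  · simp
  · rw [word, List.pairwise_ofFn]
    intro i j hij
    simpa [window] using hij

theorem invLen_mul_s_le {n i : ℕ} (hi : i < n + 1) (σ : SignedPerm (n + 1)) :
    invLen (σ * s (n + 1) i) ≤ invLen σ + 1 := by
  rcases i with _ | k
  · have := invLen_mul_s_zero σ
    split_ifs at this <;> omega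
  · have := invLen_mul_s_succ hi σ
    split_ifs at this <;> omega

/-- Every signed permutation but `1` has a descent: a window that starts with a positive letter and
increases is that of `1`. -/
theorem exists_invLen_mul_s_lt {n : ℕ} (σ : SignedPerm (n + 1)) (hσ : σ ≠ 1) :
    ∃ i < n + 1, invLen (σ * s (n + 1) i) + 1 = invLen σ := by
  by_contra! hc
  apply hσ
  have h0 : 0 < window σ 0 := by
    have h1 := hc 0 (by omega)
    have h2 := invLen_mul_s_zero σ
    have h3 : window σ 0 ≠ 0 := by
      unfold window
      rcases Int.units_eq_one_or (σ.left (σ.right 0)) with h | h <;> rw [h] <;>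
        simp only [Units.val_one, Units.val_neg] <;> omega
    split_ifs at h2 <;> omega
  have hmono : StrictMono (window σ) := by
    rw [Fin.strictMono_iff_lt_succ]
    intro i
    have h1 := hc (i + 1) (by omega)
    have h2 := invLen_mul_s_succ (show (i : ℕ) + 1 < n + 1 by omega) σ
    have h3 : window σ i.castSucc ≠ window σ i.succ := fun h =>
      absurd (window_injective_right σ h) (Fin.castSucc_lt_succ).ne
    change invLen (σ * s (n + 1) (i + 1)) +
      (if window σ i.succ < window σ i.castSucc then 1 else 0) =
      invLen σ + (if window σ i.castSucc < window σ i.succ then 1 else 0) at h2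
    split_ifs at h2 <;> omega
  have hpos : ∀ i, σ.left (σ.right i) = 1 := by
    intro i
    rcases Int.units_eq_one_or (σ.left (σ.right i)) with h | h
    · exact h
    · have h1 := hmono.monotone (Fin.zero_le i)
      have h2 := (window_neg_iff σ i).2 h
      omega
  have hw : ∀ i, window σ i = (σ.right i : ℕ) + 1 := by
    intro i
    simp [window, hpos]
  have hr : StrictMono σ.right := by
    intro i j hij
    have := hmono hij
    rw [hw, hw] at this
    rw [Fin.lt_def]
    omega
  refine SemidirectProduct.ext ?_ ?_
  · funext j
    simpa using hpos (σ.right.symm j)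
  · have := Subsingleton.elim (hr.orderIsoOfSurjective _ σ.right.surjective)
      (OrderIso.refl (Fin (n + 1)))
    ext i
    exact congrArg (fun f : Fin (n + 1) ≃o Fin (n + 1) => ((f i : Fin (n + 1)) : ℕ)) this

theorem lenB_eq {n : ℕ} (σ : SignedPerm (n + 1)) :
    lenB σ = inv (word σ) + sumNegInv σ := by
  change lenB σ = invLen σ
  have hle : ∀ l : List ℕ, (∀ i ∈ l, i < n + 1) → invLen (l.map (s (n + 1))).prod ≤ l.length := by
    intro l
    induction l using List.reverseRecOn with
    | nil => simp [invLen_one]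
    | append_singleton l i ih =>
      intro h
      simp only [List.mem_append, List.mem_singleton] at h
      rw [List.map_append, List.prod_append, List.map_singleton, List.prod_singleton,
        List.length_append, List.length_singleton]
      exact (invLen_mul_s_le (h i (Or.inr rfl)) _).trans
        (Nat.succ_le_succ (ih fun j hj => h j (Or.inl hj)))
  have hex : ∀ (k : ℕ) (σ : SignedPerm (n + 1)), invLen σ = k →
      ∃ l : List ℕ, l.length = k ∧ (∀ i ∈ l, i < n + 1) ∧ (l.map (s (n + 1))).prod = σ := by
    intro k
    induction k with
    | zero =>
      intro σ h
      refine ⟨[], rfl, by simp, ?_⟩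
      by_contra hσ
      obtain ⟨i, -, hi⟩ := exists_invLen_mul_s_lt σ fun h => hσ (by simp [h])
      omega
    | succ k ih =>
      intro σ h
      have hσ : σ ≠ 1 := by
        rintro rfl
        rw [invLen_one] at h
        omega
      obtain ⟨i, hi, hlt⟩ := exists_invLen_mul_s_lt σ hσ
      obtain ⟨l, hl, hl', hp⟩ := ih (σ * s (n + 1) i) (by omega)
      refine ⟨l ++ [i], by simp [hl], ?_, ?_⟩
      · intro j hj
        rcases List.mem_append.1 hj with hj | hj
        · exact hl' j hj
        · rw [List.mem_singleton.1 hj]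
          exact hi
      · rw [List.map_append, List.prod_append, hp, List.map_singleton, List.prod_singleton,
          mul_assoc, s_mul_self, mul_one]
  apply le_antisymm
  · exact Nat.sInf_le (hex _ σ rfl)
  · obtain ⟨l, hl, hl', hp⟩ := Nat.sInf_mem (⟨_, hex _ σ rfl⟩ : {k | ∃ l : List ℕ, l.length = k ∧
      (∀ i ∈ l, i < n + 1) ∧ (l.map (s (n + 1))).prod = σ}.Nonempty)
    have := hle l hl'
    rw [hp, hl] at this
    exact this

/-! ### The statistics in terms of words -/

/-- `lrMin` counts the letters below `m` and below everything that precedes them. -/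
theorem card_lrMin {n : ℕ} (m : ℤ) (x : Fin n → ℤ) :
    (Finset.univ.filter fun j : Fin n => x j < m ∧ ∀ i : Fin n, i < j → x j < x i).card =
      lrMin m (List.ofFn x) := by
  induction n generalizing m with
  | zero => simp [lrMin]
  | succ n ih =>
    rw [List.ofFn_succ, lrMin, ← ih, Finset.card_filter, Finset.card_filter, Fin.sum_univ_succ]
    congr 1
    · simp
    · refine Finset.sum_congr rfl fun j _ => ?_
      simp only [Fin.forall_fin_succ, Fin.succ_pos, forall_true_left, Fin.succ_lt_succ_iff,
        lt_min_iff, and_assoc]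

theorem delB_eq {n : ℕ} (σ : SignedPerm (n + 1)) :
    delB σ = lrMin (window σ 0) (List.ofFn fun i : Fin n => window σ i.succ) := by
  rw [← card_lrMin, delB, Finset.card_filter, Finset.card_filter, Fin.sum_univ_succ]
  simp [Fin.forall_fin_succ]

theorem lenL_eq {n : ℕ} (σ : SignedPerm (n + 1)) : lenL σ = wordLen (word σ) + sumNegInv σ := by
  rw [lenL, lenB_eq, delB_eq, word_succ, wordLen]
  push_cast
  ring

theorem lenLD_eq {n : ℕ} (σ : SignedPerm (n + 1)) :
    lenLD σ = (sumNegInv σ - (Neg σ).card : ℤ) + wordLen (word σ) := by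
  have := lenL_eq σ
  rw [lenL] at this
  rw [lenLD, lenD]
  linarith

theorem rmajL_eq {n : ℕ} (σ : SignedPerm (n + 1)) : rmajL σ = wordMaj (word σ) := by
  have hi : Finset.Icc 1 (n - 1) = Finset.Ico (0 + 1) (n - 1 + 1) := by
    ext i
    simp only [Finset.mem_Icc, Finset.mem_Ico]
    omega
  rw [wordMaj_eq_sum _ (nodup_word σ), rmajL, DesA, Finset.sum_filter, length_word, hi,
    ← Finset.sum_Ico_add', Finset.range_eq_Ico]
  refine Finset.sum_congr (by congr 1) fun k hk => ?_
  rw [Finset.mem_Ico] at hk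
  have ha : word (σ * a n (k + 1)) = swapAt (k + 1) (swapAt 0 (word σ)) := by
    rw [a, ← mul_assoc, word_mul_s_succ (by omega), word_mul_s_succ (by omega)]
  have hs : sumNegInv (σ * a n (k + 1)) = sumNegInv σ := by
    rw [sumNegInv_eq, sumNegInv_eq, a, ← mul_assoc, left_mul_s_succ, left_mul_s_succ]
  simp only [lenL_eq, ha, hs, add_le_add_iff_right]
  congr 1
  push_cast
  ring

theorem drmajLD_eq {n : ℕ} (σ : SignedPerm (n + 1)) :
    drmajLD σ = (sumNegInv σ - (Neg σ).card : ℤ) + wordMaj (word σ) := by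
  rw [drmajLD, rmajL_eq]
  ring

/-! ### Summation over the even-signed even permutations -/

/-- A sum over the alternating group of a function invariant under an odd permutation is half of
the sum over the symmetric group. -/
theorem two_mul_sum_alternatingGroup {α R : Type*} [Fintype α] [DecidableEq α] [CommRing R]
    (f : Perm α → R) (t : Perm α) (ht : Perm.sign t = -1) (hf : ∀ w, f (w * t) = f w) :
    2 * ∑ w : alternatingGroup α, f w = ∑ w, f w := by
  have h1 : ∑ w : alternatingGroup α, f w =
      ∑ w ∈ Finset.univ.filter fun w : Perm α => Perm.sign w = 1, f w :=
    (Finset.sum_subtype _ (by simp [Perm.mem_alternatingGroup]) f).symm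
  -- Right multiplication by `t` maps the odd permutations to the even ones.
  have h2 : ∑ w ∈ Finset.univ.filter (fun w : Perm α => ¬ Perm.sign w = 1), f w =
      ∑ w ∈ Finset.univ.filter fun w : Perm α => Perm.sign w = 1, f w := by
    refine Finset.sum_equiv (Equiv.mulRight t) ?_ fun w _ => (hf w).symm
    intro w
    rcases Int.units_eq_one_or (Perm.sign w) with h | h <;> simp [h, ht]
  rw [← Finset.sum_filter_add_sum_filter_not Finset.univ (fun w : Perm α => Perm.sign w = 1),
    h2, h1, two_mul]

/-- The rearrangements of distinct integers by even permutations alone: `wordMaj` and `wordLen`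
are still equidistributed, since both are invariant under exchanging the first two letters. -/
theorem sum_alternatingGroup_wordMaj_eq {n : ℕ} (x : Fin n → ℤ) (hx : Function.Injective x) :
    ∑ w : alternatingGroup (Fin n),
        (T (wordMaj (List.ofFn (x ∘ (w : Perm (Fin n))))) : LaurentPolynomial ℤ) =
      ∑ w : alternatingGroup (Fin n), T (wordLen (List.ofFn (x ∘ (w : Perm (Fin n))))) := by
  match n, x, hx with
  | 0, x, _ => simp [wordMaj, wordLen]
  | 1, x, _ => simp [wordMaj, wordLen, altMaj, inv, lrMin]
  | n + 2, x, hx =>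
    have ht : Perm.sign (swap (⟨0, by omega⟩ : Fin (n + 2)) ⟨0 + 1, by omega⟩) = -1 :=
      Perm.sign_swap (by simp)
    have hw : ∀ w : Perm (Fin (n + 2)), List.ofFn (x ∘ (w * swap (⟨0, by omega⟩ : Fin (n + 2))
        ⟨0 + 1, by omega⟩ : Perm (Fin (n + 2)))) = swapAt 0 (List.ofFn (x ∘ w)) := fun w =>
      ofFn_comp_swap (x ∘ w) 0 (by omega)
    have h1 := two_mul_sum_alternatingGroup
      (fun w => (T (wordMaj (List.ofFn (x ∘ w))) : LaurentPolynomial ℤ)) _ ht fun w => by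
        simp only [hw, wordMaj_swapAt_zero]
    have h2 := two_mul_sum_alternatingGroup
      (fun w => (T (wordLen (List.ofFn (x ∘ w))) : LaurentPolynomial ℤ)) _ ht fun w => by
        simp only [hw]
        rw [wordLen_swapAt_zero _ (List.nodup_ofFn.2 (hx.comp w.injective))]
    have h3 : (2 : LaurentPolynomial ℤ) ≠ 0 := by
      intro h
      rw [← map_ofNat Polynomial.toLaurent 2,
        map_eq_zero_iff _ Polynomial.toLaurent_injective] at h
      simp at h
    exact mul_left_cancel₀ h3 (h1.trans ((sum_wordMaj_eq_sum_wordLen x hx).trans h2.symm))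

/-- An element of `(L ∩ D)_n` is a sign vector of product one together with an even permutation. -/
def LDEquiv (n : ℕ) :
    LD n ≃ {e : Fin n → ℤˣ // ∏ j, e j = 1} × alternatingGroup (Fin n) where
  toFun π := (⟨π.1.left, (even_card_Neg_iff π.1).1 π.2.2⟩, ⟨π.1.right, π.2.1⟩)
  invFun p := ⟨⟨p.1.1, p.2.1⟩, p.2.2, (even_card_Neg_iff ⟨p.1.1, p.2.1⟩).2 p.1.2⟩
  left_inv _ := rfl
  right_inv _ := rfl

end SignedEven

theorem proposition4p2 (n : ℕ) :
    ∑ π : SignedEven.LD (n + 1),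
        (LaurentPolynomial.T (SignedEven.drmajLD (π : SignedEven.SignedPerm (n + 1))) :
          LaurentPolynomial ℤ) =
      ∑ π : SignedEven.LD (n + 1),
        (LaurentPolynomial.T (SignedEven.lenLD (π : SignedEven.SignedPerm (n + 1))) :
          LaurentPolynomial ℤ) := by
  simp only [SignedEven.drmajLD_eq, SignedEven.lenLD_eq, SignedEven.sumNegInv_eq,
    SignedEven.card_Neg_eq, LaurentPolynomial.T_add]
  rw [← Equiv.sum_comp (SignedEven.LDEquiv (n + 1)).symm,
    ← Equiv.sum_comp (SignedEven.LDEquiv (n + 1)).symm, Fintype.sum_prod_type,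
    Fintype.sum_prod_type]
  refine Finset.sum_congr rfl fun e _ => ?_
  -- For a fixed sign vector `e`, the word of `(e, w)` is the word of `(e, 1)` rearranged by `w`, and
  -- the part of the exponent that depends on the signs alone factors out.
  have key := congrArg (LaurentPolynomial.T
      (((∑ j, if e.1 j = -1 then (j : ℕ) + 1 else 0 : ℕ) : ℤ) -
        ((∑ j, if e.1 j = -1 then 1 else 0 : ℕ) : ℤ)) * ·)
    (SignedEven.sum_alternatingGroup_wordMaj_eq (SignedEven.window ⟨e.1, 1⟩)
      (SignedEven.window_injective_right _))
  simp only [Finset.mul_sum] at key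
  exact key
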